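/- Let $\mathbf P$ be a set of propositions and let formulas be given by $\phi ::= p \mid \neg\phi \mid (\phi\wedge\phi)\mid \Box\phi\mid \boxdot\phi$ with $p\in\mathbf P$, where $\boxdot$ denotes the bundled "double box" modality. A Kripke model $\mathcal M=(S,R,V)$ consists of a non-empty set $S$, a relation $R\subseteq S\times S$ and a valuation $V:\mathbf P\to\mathcal P(S)$. For $s\in S$ let $\kappa_s=|\{t: sRt\}|$, let $L_s=\{t: sRt\text{ and }\exists u,\ tRu\}$ and $\lambda_s=|L_s|$; cardinals are identified with initial ordinals. It is assumed that for every $s\in S$ the cardinal of $\{(t,u): sRt,\ tRu\}$ is regular whenever it is infinite. Ordinal arithmetic is used throughout. For ordinals $\alpha,\beta,\gamma$, write $\beta\sim_\alpha\gamma$ iff $\beta=\gamma=0$ or ($\beta<\gamma\cdot\aleph_\alpha$ and $\gamma<\beta\cdot\aleph_\alpha$); this is an equivalence relation with classes $[\beta]_\alpha$, ordered by $[\beta]_\alpha<[\gamma]_\alpha$ iff $\beta\not\sim_\alpha\gamma$ and $\beta<\gamma$. For a family $(h(\gamma))_{\gamma<\lambda}$ of ordinals, $\sum h$ is the transfinite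 ordinal sum (with $0$ for the empty sum, ordinal addition at successor steps, suprema at limit steps). Fix arbitrarily, for every Kripke model and every world $s$, a bijection $f_s:\lambda_s\to L_s$ and, for each $t\in L_s$, a bijection $g_t:\kappa_t\to\{u:tRu\}$. Truth $\mathcal M,s\vDash\phi$ is defined as usual for propositions, $\neg$ and $\wedge$, and: - if $\kappa_s$ is infinite, $\mathcal M,s\vDash\Box\phi$ iff $|\{t:sRt,\ \mathcal M,t\vDash\phi\}|>|\{t:sRt,\ \mathcal M,t\nvDash\phi\}|$; otherwise $\mathcal M,s\vDash\Box\phi$ iff $\mathcal M,t\vDash\phi$ for all $t$ with $sRt$; - for $\gamma<\lambda_s$ and $t=f_s(\gamma)$ let $h(\gamma)=\kappa_t$, and let $h^+(\gamma)$ (resp. $h^-(\gamma)$) be the order type of the set of successors $u$ of $t$ with $\mathcal M,u\vDash\phi$ (resp. $\mathcal M,u\nvDash\phi$) in the well-order induced by $g_t$. If $|\sum h|=\aleph_\zeta$ is infinite, $\mathcal M,s\vDash\boxdot\phi$ iff $[\sum h^+]_\zeta>[\sum h^-]_\zeta$; otherwise $\mathcal M,s\vDash\boxdot\phi$ iff $\mathcal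 M,u\vDash\phi$ for all $t,u$ with $sRt$ and $tRu$. Then, for every formula $\phi$: $\phi$ is satisfiable in some Kripke model (i.e. true at some world of it) if and only if $\phi$ is satisfiable in some Kripke model $(S,R,V)$ with $|S|<\aleph_\omega$. -/

import Mathlib

open Cardinal Ordinal

universe u v

noncomputable section

/-! ### Ordinal arithmetic -/

namespace OrdArith

/-- `β ∼_α γ`: both are `0`, or `β < γ · ℵ_α` and `γ < β · ℵ_α` (ordinal multiplication, with `ℵ_α`
regarded as the initial ordinal `ω_ α`). When exactly one of `β`, `γ` is `0` the second alternative
fails. -/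
def Sim (α β γ : Ordinal.{u}) : Prop :=
  (β = 0 ∧ γ = 0) ∨ (β < γ * ω_ α ∧ γ < β * ω_ α)

/-- `[β]_α < [γ]_α` for the `∼_α`-classes of `β` and `γ`. -/
def ClassLT (α β γ : Ordinal.{u}) : Prop :=
  ¬ Sim α β γ ∧ β < γ

/-- The partial sum `∑_β f` of a family of ordinals indexed by the ordinals below `α`, by transfinite
recursion on `β`. It is only used for `β ≤ α` (past `α` the summands are read as `0`). -/
def partialSum {α : Ordinal.{u}} (f : Set.Iio α → Ordinal.{u}) (β : Ordinal.{u}) : Ordinal.{u} :=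
  open Classical in
  Ordinal.limitRecOn (motive := fun _ => Ordinal.{u}) β 0
    (fun γ s => s + if h : γ < α then f ⟨γ, h⟩ else 0)
    (fun γ _ s => ⨆ δ : Set.Iio γ, s δ.1 δ.2)

/-- The transfinite ordinal sum `∑ f` of a family indexed by the ordinals below `α`. -/
def transSum {α : Ordinal.{u}} (f : Set.Iio α → Ordinal.{u}) : Ordinal.{u} :=
  partialSum f α

/-- The relation on `A` obtained by pulling back the order of the ordinals along an injection. -/
def pullLT {A : Type u} {α : Ordinal.{u}} (g : A ↪ Set.Iio α) (a b : A) : Prop := g a < g b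

theorem pullLT_isWellOrder {A : Type u} {α : Ordinal.{u}} (g : A ↪ Set.Iio α) :
    IsWellOrder A (pullLT g) :=
  RelEmbedding.isWellOrder (⟨g, Iff.rfl⟩ : pullLT g ↪r ((· < ·) : Set.Iio α → Set.Iio α → Prop))

/-- The ordinal of the well-order that `A` inherits from an injection into the ordinals below `α`. -/
def pullType {A : Type u} {α : Ordinal.{u}} (g : A ↪ Set.Iio α) : Ordinal.{u} :=
  letI := pullLT_isWellOrder g
  Ordinal.type (pullLT g)

end OrdArith

/-! ### Language and models -/

/-- Formulas of duplex transfinite modal logic over the propositions `P`. -/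
inductive DTML (P : Type v) : Type v
  | prop (p : P) : DTML P
  | neg (φ : DTML P) : DTML P
  | conj (φ ψ : DTML P) : DTML P
  | box (φ : DTML P) : DTML P
  | boxbox (φ : DTML P) : DTML P

/-- A Kripke model: a non-empty set of worlds, an arbitrary binary relation and a valuation. -/
structure KripkeModel (P : Type v) where
  /-- the possible worlds -/
  World : Type u
  /-- there is a world -/
  nonempty : Nonempty World
  /-- the accessibility relation -/
  R : World → World → Prop
  /-- the valuation -/
  V : P → Set World

namespace KripkeModel

open OrdArith

variable {P : Type v} (M : KripkeModel.{u, v} P)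

/-- The set of successors of `s`. -/
def succs (s : M.World) : Set M.World := {t | M.R s t}

/-- The set of live successors of `s`: those that have a successor of their own. -/
def liveSuccs (s : M.World) : Set M.World := {t | M.R s t ∧ ∃ w, M.R t w}

/-- The successor cardinality `κ_s`. -/
def kap (s : M.World) : Cardinal.{u} := #(M.succs s)

/-- The live successor cardinality `λ_s`. -/
def lam (s : M.World) : Cardinal.{u} := #(M.liveSuccs s)

/-- A choice of the bijections used to evaluate `⊡⊡`: for each world `s` a bijection `f_s` from the
initial ordinal `λ_s` onto the live successors of `s`, and for each live successor `t` of `s` a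
bijection `g_t` from the initial ordinal `κ_t` onto the successors of `t` (it may depend on `s`). -/
structure Enumeration where
  /-- the bijection `f_s` -/
  f : ∀ s : M.World, Set.Iio (M.lam s).ord ≃ M.liveSuccs s
  /-- the bijections `g_t` -/
  g : ∀ (s : M.World) (t : M.liveSuccs s), Set.Iio (M.kap t).ord ≃ M.succs t

variable {M}

/-- `h : λ_s → Ord`, `h(γ) = κ_{f_s(γ)}`, a cardinal being identified with its initial ordinal. -/
def Enumeration.h (e : M.Enumeration) (s : M.World) (γ : Set.Iio (M.lam s).ord) : Ordinal.{u} :=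
  (M.kap (e.f s γ)).ord

/-- For a set `X` of worlds, the function `λ_s → Ord` that maps `γ` to the ordinal of the well-order
that `g_t`, for `t = f_s(γ)`, induces on the subset of those successors of `t` that lie in `X`. -/
def Enumeration.hOn (e : M.Enumeration) (s : M.World) (X : Set M.World)
    (γ : Set.Iio (M.lam s).ord) : Ordinal.{u} :=
  pullType (A := {w : M.succs (e.f s γ) // (w : M.World) ∈ X})
    ((Function.Embedding.subtype _).trans (e.g s (e.f s γ)).symm.toEmbedding)

/-- The satisfaction relation `M, s ⊨ φ`, evaluated with the bijections `e`. -/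
def Sat (e : M.Enumeration) : DTML P → M.World → Prop
  | .prop p, s => s ∈ M.V p
  | .neg φ, s => ¬ Sat e φ s
  | .conj φ ψ, s => Sat e φ s ∧ Sat e ψ s
  | .box φ, s =>
      (ℵ₀ ≤ M.kap s ∧
        #{t : M.World // M.R s t ∧ ¬ Sat e φ t} < #{t : M.World // M.R s t ∧ Sat e φ t}) ∨
      (M.kap s < ℵ₀ ∧ ∀ t, M.R s t → Sat e φ t)
  | .boxbox φ, s =>
      (∃ ζ : Ordinal.{u}, (transSum (e.h s)).card = ℵ_ ζ ∧
        ClassLT ζ (transSum (e.hOn s {w | ¬ Sat e φ w})) (transSum (e.hOn s {w | Sat e φ w}))) ∨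
      ((transSum (e.h s)).card < ℵ₀ ∧ ∀ t w, M.R s t → M.R t w → Sat e φ w)

variable (M)

/-- The standing regularity assumption, in its weakest useful form: for every world `s`, the cardinal
`|∑ h|`, which is the number of pairs `(t, w)` with `s R t` and `t R w`, is regular if infinite.
(This is what makes the evaluation of `⊡⊡` independent of the bijections.) -/
def Regular : Prop :=
  ∀ s : M.World, ℵ₀ ≤ #{q : M.World × M.World // M.R s q.1 ∧ M.R q.1 q.2} →
    (#{q : M.World × M.World // M.R s q.1 ∧ M.R q.1 q.2}).IsRegular

/-- The bijections can always be chosen. -/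
theorem nonempty_enumeration : Nonempty M.Enumeration := by
  have key : ∀ A : Type u, Nonempty (Set.Iio (#A).ord ≃ A) := fun A => by
    rw [← Cardinal.lift_mk_eq'.{u + 1, u}]
    simp
  exact ⟨⟨fun s => (key _).some, fun s t => (key _).some⟩⟩

end KripkeModel

end

/-! Both modalities only compare cardinals with a threshold, and finitely many such comparisons
survive a collapse of the infinite cardinals onto an initial segment of the alephs.

Let `c`, the number of two-step paths from `s`, be infinite, hence regular, with initial ordinal Ω.
Both sums used by the double box are at most Ω·Ω. The sum for a set `X` reaches Ω·Ω exactly when at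
least `c` successors have `c` successors in `X` (`transSum_lt_mul_self`, `mul_self_le_transSum`),
and is below Ω exactly when fewer than `c` paths end in `X`. Since β·Ω is Ω for 0 < β < Ω and Ω·Ω
for Ω ≤ β < Ω·Ω, the comparison of classes only sees these regions. So `sat_boxbox_iff` describes
truth by the cardinals `pairs` and `heavy` alone, whatever the enumerations.

For a satisfied formula only the truth sets of its subformulas matter. They split the successors of
each world into finitely many classes (`SuccClass`). One representative per class is kept and copied
`collapse C c.mult` times, down to the modal depth. As `collapse C` commutes with finite sums and
with products and is strict at the thresholds in `C`, all comparisons persist (`sat_collapsed_iff`).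
Replacing a class by copies of one member may change the number of two-step paths, but not its
comparison with `c`; this again needs regularity (`repPairs_lt_pairs_iff`). Finitely many nodes
times some ℵ_n labels stay below ℵ_ω, where every infinite cardinal is regular. -/

namespace OrdArith

/-! ### Transfinite sums -/

open Classical in
/-- The extension of a family of ordinals indexed by the ordinals below `α` by zero. -/
noncomputable def extend {α : Ordinal.{u}} (f : Set.Iio α → Ordinal.{u}) (γ : Ordinal.{u}) :
    Ordinal.{u} :=
  if h : γ < α then f ⟨γ, h⟩ else 0

section

variable {α : Ordinal.{u}} (f : Set.Iio α → Ordinal.{u})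

theorem extend_of_lt {γ : Ordinal.{u}} (h : γ < α) : extend f γ = f ⟨γ, h⟩ := dif_pos h

theorem partialSum_zero : partialSum f 0 = 0 := by
  simp [partialSum, Ordinal.limitRecOn_zero]

theorem partialSum_add_one (γ : Ordinal.{u}) :
    partialSum f (γ + 1) = partialSum f γ + extend f γ := by
  unfold partialSum extend
  rw [Ordinal.limitRecOn_add_one]

theorem partialSum_limit {γ : Ordinal.{u}} (hγ : Order.IsSuccLimit γ) :
    partialSum f γ = ⨆ δ : Set.Iio γ, partialSum f δ := by
  unfold partialSum
  rw [Ordinal.limitRecOn_limit _ _ _ _ hγ]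

theorem partialSum_le_limit {γ : Ordinal.{u}} (hγ : Order.IsSuccLimit γ) {δ : Ordinal.{u}}
    (h : δ < γ) : partialSum f δ ≤ partialSum f γ := by
  rw [partialSum_limit f hγ]
  exact Ordinal.le_iSup (fun δ : Set.Iio γ => partialSum f δ) ⟨δ, h⟩

theorem partialSum_limit_le {γ b : Ordinal.{u}} (hγ : Order.IsSuccLimit γ)
    (h : ∀ δ < γ, partialSum f δ ≤ b) : partialSum f γ ≤ b := by
  rw [partialSum_limit f hγ]
  exact Ordinal.iSup_le fun δ => h δ.1 δ.2

theorem partialSum_mono : Monotone (partialSum f) := by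
  intro a b hab
  induction b using Ordinal.limitRecOn with
  | zero => simp_all
  | add_one b ih =>
    rcases hab.eq_or_lt with rfl | h
    · exact le_rfl
    · rw [partialSum_add_one]
      exact (ih (Order.le_of_lt_add_one h)).trans le_self_add
  | limit b hb _ =>
    rcases hab.eq_or_lt with rfl | h
    · exact le_rfl
    · exact partialSum_le_limit f hb h

theorem partialSum_add_le {γ δ : Ordinal.{u}} (h : γ < δ) :
    partialSum f γ + extend f γ ≤ partialSum f δ := by
  rw [← partialSum_add_one]
  exact partialSum_mono f (Order.add_one_le_of_lt h)

theorem exists_lt_partialSum_add {β x : Ordinal.{u}} (hx : x < partialSum f β) :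
    ∃ γ < β, partialSum f γ ≤ x ∧ x < partialSum f γ + extend f γ := by
  induction β using Ordinal.limitRecOn with
  | zero => simp [partialSum_zero] at hx
  | add_one β ih =>
    rcases lt_or_ge x (partialSum f β) with h | h
    · obtain ⟨γ, hγ, h'⟩ := ih h
      exact ⟨γ, hγ.trans (lt_add_one β), h'⟩
    · exact ⟨β, lt_add_one β, h, by rwa [← partialSum_add_one]⟩
  | limit β hβ ih =>
    obtain ⟨δ, hδ, h⟩ : ∃ δ < β, x < partialSum f δ := by
      by_contra! hcon
      exact absurd hx (not_lt.2 (partialSum_limit_le f hβ hcon))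
    obtain ⟨γ, hγ, h'⟩ := ih δ hδ h
    exact ⟨γ, hγ.trans hδ, h'⟩

/-- The ordinals below a transfinite sum form the disjoint union of the ordinals below the
summands. -/
noncomputable def sigmaEquivPartialSum (β : Ordinal.{u}) :
    (Σ γ : Set.Iio β, Set.Iio (extend f γ)) ≃ Set.Iio (partialSum f β) :=
  Equiv.ofBijective
    (fun p => ⟨partialSum f p.1 + p.2,
      (add_lt_add_right p.2.2 _).trans_le (partialSum_add_le f p.1.2)⟩) <| by
    constructor
    · rintro ⟨⟨γ, hγ⟩, ⟨y, hy⟩⟩ ⟨⟨δ, hδ⟩, ⟨z, hz⟩⟩ h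
      replace h : partialSum f γ + y = partialSum f δ + z := congrArg Subtype.val h
      rcases lt_trichotomy γ δ with hlt | rfl | hlt
      · have := (add_lt_add_right hy _).trans_le (partialSum_add_le f hlt)
        exact absurd (h ▸ this) (not_lt.2 le_self_add)
      · have : y = z := by simpa using h
        subst this
        rfl
      · have := (add_lt_add_right hz _).trans_le (partialSum_add_le f hlt)
        exact absurd (h.symm ▸ this) (not_lt.2 le_self_add)
    · rintro ⟨x, hx⟩
      obtain ⟨γ, hγ, h1, h2⟩ := exists_lt_partialSum_add f hx
      refine ⟨⟨⟨γ, hγ⟩, ⟨x - partialSum f γ, ?_⟩⟩, ?_⟩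
      · exact (Ordinal.sub_lt_of_le h1).2 h2
      · simp [Ordinal.add_sub_cancel_of_le h1]

theorem lift_card_partialSum (β : Ordinal.{u}) :
    Cardinal.lift.{u + 1} (partialSum f β).card =
      Cardinal.sum fun γ : Set.Iio β => Cardinal.lift.{u + 1} (extend f γ).card := by
  have := Cardinal.mk_congr (sigmaEquivPartialSum f β)
  rw [Cardinal.mk_sigma] at this
  simpa [Cardinal.mk_Iio_ordinal] using this.symm

/-- `Set.Iio α` lives one universe up; reindexing along `e` brings the cardinal sum back to universe
`u`. -/
theorem card_transSum {ι : Type u} (e : Set.Iio α ≃ ι) :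
    (transSum f).card = Cardinal.sum fun i : ι => (f (e.symm i)).card := by
  have h : ∀ i : Set.Iio α, Cardinal.lift.{u} #(Set.Iio (extend f i)) =
      Cardinal.lift.{u + 1} #(f (e.symm (e i))).ToType := by
    intro i
    rw [Cardinal.mk_Iio_ordinal, extend_of_lt f i.2]
    simp
  have key := (Cardinal.mk_sigma_congr_lift
    (g := fun i => (f (e.symm i)).ToType) e h).symm.trans
    (congrArg Cardinal.lift.{u} (Cardinal.mk_congr (sigmaEquivPartialSum f α)))
  rw [Cardinal.mk_Iio_ordinal, Cardinal.mk_sigma] at key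
  rw [← Cardinal.lift_inj.{u, u + 1}, Cardinal.lift_sum]
  simpa [transSum] using key.symm

theorem partialSum_lt_ord {c : Cardinal.{u}} (hc : c.IsRegular) (hf : ∀ γ, f γ < c.ord)
    {β : Ordinal.{u}} (hβ : β < c.ord) : partialSum f β < c.ord := by
  rw [Cardinal.lt_ord, ← Cardinal.lift_lt.{u, u + 1}, lift_card_partialSum]
  refine Cardinal.sum_lt_of_isRegular hc.lift ?_ fun γ => ?_
  · rw [Cardinal.mk_Iio_ordinal, Cardinal.lift_lt]
    exact Cardinal.lt_ord.1 hβ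
  · rw [Cardinal.lift_lt, ← Cardinal.lt_ord]
    unfold extend
    split_ifs
    · exact hf _
    · exact hc.ord_pos

theorem partialSum_le_ord {c : Cardinal.{u}} (hc : c.IsRegular) (hf : ∀ γ, f γ < c.ord)
    {β : Ordinal.{u}} (hβ : β ≤ c.ord) : partialSum f β ≤ c.ord := by
  rcases hβ.lt_or_eq with h | rfl
  · exact (partialSum_lt_ord f hc hf h).le
  · exact partialSum_limit_le f (Cardinal.isSuccLimit_ord hc.aleph0_le)
      fun δ hδ => (partialSum_lt_ord f hc hf hδ).le

theorem partialSum_le_mul {b : Ordinal.{u}} (hf : ∀ γ, f γ ≤ b) (β : Ordinal.{u}) :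
    partialSum f β ≤ b * β := by
  induction β using Ordinal.limitRecOn with
  | zero => simp [partialSum_zero]
  | add_one β ih =>
    rw [partialSum_add_one, mul_add_one]
    refine add_le_add ih ?_
    unfold extend
    split_ifs
    · exact hf _
    · exact zero_le
  | limit β hβ ih =>
    exact partialSum_limit_le f hβ fun δ hδ => (ih δ hδ).trans (mul_le_mul_right hδ.le _)

end

/-! ### Transfinite sums against the square of a regular initial ordinal -/

section

variable {α : Ordinal.{u}} {f : Set.Iio α → Ordinal.{u}} {ι : Type u} {c : Cardinal.{u}}

/-- A transfinite sum of fewer than `c` ordinals at least `c.ord`, and others below, stays below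
the square of `c.ord`. -/
theorem transSum_lt_mul_self (hc : c.IsRegular) (hα : α ≤ c.ord) (e : Set.Iio α ≃ ι)
    (hf : ∀ γ, f γ ≤ c.ord) (h : #{i : ι // c.ord ≤ f (e.symm i)} < c) :
    transSum f < c.ord * c.ord := by
  classical
  have hlim := Cardinal.isSuccLimit_ord hc.aleph0_le
  -- By regularity, fewer than `c` large summands occur at bounded positions. The `+ 1` puts `β₀`
  -- strictly past all of them.
  let β₀ : Ordinal.{u} := ⨆ i : {i : ι // c.ord ≤ f (e.symm i)}, ((e.symm i.1 : Ordinal) + 1)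
  have hβ₀ : β₀ < c.ord := by
    refine Ordinal.iSup_lt_of_lt_cof (hc.cof_ord.symm ▸ h) fun i => ?_
    exact hlim.add_one_lt ((e.symm i.1).2.trans_le hα)
  let f' : Set.Iio α → Ordinal.{u} := fun γ => if c.ord ≤ f γ then 0 else f γ
  have hf' : ∀ γ, f' γ < c.ord := by
    intro γ
    simp only [f']
    split_ifs with hγ
    · exact hc.ord_pos
    · exact not_le.1 hγ
  -- Up to `β₀` the crude bound `c.ord` per summand suffices; beyond it `f` and `f'` agree, and `f'`
  -- sums to at most `c.ord`.
  have key : ∀ β, partialSum f β ≤ c.ord * β₀ + partialSum f' β := by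
    intro β
    induction β using Ordinal.limitRecOn with
    | zero => simp [partialSum_zero]
    | add_one β ih =>
      rcases lt_or_ge β β₀ with hβ | hβ
      · exact ((partialSum_le_mul f hf _).trans
          (mul_le_mul_right (Order.add_one_le_of_lt hβ) _)).trans le_self_add
      · rw [partialSum_add_one, partialSum_add_one, ← add_assoc]
        refine add_le_add ih ?_
        unfold extend
        split_ifs with hβα
        · have : ¬ c.ord ≤ f ⟨β, hβα⟩ := by
            intro hcon
            have := Ordinal.le_iSup
              (fun i : {i : ι // c.ord ≤ f (e.symm i)} => ((e.symm i.1 : Ordinal) + 1))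
              ⟨e ⟨β, hβα⟩, by simpa using hcon⟩
            simp only [Equiv.symm_apply_apply] at this
            exact absurd (lt_add_one β) (not_lt.2 (this.trans hβ))
          simp [f', this]
        · exact le_rfl
    | limit β hβ ih =>
      refine partialSum_limit_le f hβ fun δ hδ => (ih δ hδ).trans ?_
      exact add_le_add le_rfl (partialSum_mono f' hδ.le)
  calc transSum f ≤ c.ord * β₀ + c.ord :=
        (key α).trans (add_le_add le_rfl (partialSum_le_ord f' hc hf' hα))
    _ = c.ord * (β₀ + 1) := (mul_add_one _ _).symm
    _ < c.ord * c.ord := by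
        exact mul_lt_mul_of_pos_left (hlim.add_one_lt hβ₀) hc.ord_pos

theorem mul_self_le_transSum (hc : c.IsRegular) (e : Set.Iio α ≃ ι)
    (h : c ≤ #{i : ι // c.ord ≤ f (e.symm i)}) : c.ord * c.ord ≤ transSum f := by
  by_contra! hcon
  have hlim := Cardinal.isSuccLimit_ord hc.aleph0_le
  obtain ⟨b, hb, hlt⟩ := (Ordinal.lt_mul_iff_of_isSuccLimit hlim).1 hcon
  have hq : ∀ γ : Set.Iio α, partialSum f γ / c.ord < b := by
    intro γ
    rw [← Ordinal.lt_mul_iff_div_lt hc.ord_pos.ne']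
    exact (partialSum_mono f γ.2.le).trans_lt hlt
  -- Each large summand raises the quotient of the partial sum by `c.ord` by at least one, so large
  -- positions inject into the ordinals below `b`, of which there are fewer than `c`.
  have hmono : ∀ γ δ : Set.Iio α, c.ord ≤ f γ → γ < δ →
      partialSum f γ / c.ord < partialSum f δ / c.ord := by
    intro γ δ hγ hγδ
    rw [← Order.add_one_le_iff, ← Ordinal.mul_le_iff_le_div hc.ord_pos.ne', mul_add_one]
    refine le_trans (add_le_add (Ordinal.mul_div_le _ _) ?_) (partialSum_add_le f hγδ)
    rw [extend_of_lt f γ.2]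
    exact hγ
  have hinj : Function.Injective
      (fun i : {i : ι // c.ord ≤ f (e.symm i)} =>
        (⟨partialSum f (e.symm i.1) / c.ord, hq _⟩ : Set.Iio b)) := by
    intro i j hij
    replace hij : partialSum f (e.symm i.1) / c.ord = partialSum f (e.symm j.1) / c.ord :=
      congrArg Subtype.val hij
    rcases lt_trichotomy (e.symm i.1) (e.symm j.1) with hlt | heq | hlt
    · exact absurd hij (hmono _ _ i.2 hlt).ne
    · exact Subtype.ext (e.symm.injective heq)
    · exact absurd hij (hmono _ _ j.2 hlt).ne'
  have h2 := Cardinal.lift_mk_le_lift_mk_of_injective hinj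
  rw [Cardinal.mk_Iio_ordinal] at h2
  simp only [Cardinal.lift_lift, Cardinal.lift_le] at h2
  exact absurd (h.trans h2) (not_le.2 (Cardinal.lt_ord.1 hb))

theorem classLT_iff {ζ β γ : Ordinal.{u}} : ClassLT ζ β γ ↔ γ ≠ 0 ∧ β * ω_ ζ ≤ γ := by
  have hΩ : 1 < ω_ ζ := (Ordinal.one_lt_omega0).trans_le (Ordinal.omega0_le_omega ζ)
  unfold ClassLT Sim
  constructor
  · rintro ⟨h1, h2⟩
    have hγ : 0 < γ := bot_le.trans_lt h2
    refine ⟨hγ.ne', ?_⟩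
    by_contra! hcon
    refine h1 (Or.inr ⟨h2.trans_le ?_, hcon⟩)
    exact le_mul_of_one_le_right' hΩ.le
  · rintro ⟨h1, h2⟩
    refine ⟨?_, ?_⟩
    · rintro (h | h)
      · exact h1 h.2
      · exact absurd h.2 (not_lt.2 h2)
    · rcases eq_or_ne β 0 with rfl | hβ
      · exact pos_iff_ne_zero.2 h1
      · refine lt_of_lt_of_le ?_ h2
        calc β = β * 1 := (mul_one β).symm
          _ < β * ω_ ζ := mul_lt_mul_of_pos_left hΩ (pos_iff_ne_zero.2 hβ)

/-- Right multiplication by `ω_ ζ` absorbs positive factors below it. The hypothesis `h` rules out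
both ordinals being below `ω_ ζ`, where zero and nonzero would have to be told apart. -/
theorem classLT_of_le_mul_self {ζ β γ : Ordinal.{u}} (hβ : β ≤ ω_ ζ * ω_ ζ)
    (hγ : γ ≤ ω_ ζ * ω_ ζ) (h : β < ω_ ζ → ω_ ζ ≤ γ) :
    ClassLT ζ β γ ↔
      (ω_ ζ * ω_ ζ ≤ γ ∧ β < ω_ ζ * ω_ ζ) ∨ (γ < ω_ ζ * ω_ ζ ∧ β < ω_ ζ) := by
  have hΩ : 1 < ω_ ζ := (Ordinal.one_lt_omega0).trans_le (Ordinal.omega0_le_omega ζ)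
  have hpos : 0 < ω_ ζ := zero_lt_one.trans hΩ
  have hlim : Order.IsSuccLimit (ω_ ζ) := by
    rw [← Cardinal.ord_aleph]
    exact Cardinal.isSuccLimit_ord (Cardinal.aleph0_le_aleph ζ)
  have hprin : Ordinal.IsPrincipal (· * ·) (ω_ ζ) := Ordinal.isPrincipal_mul_omega ζ
  rw [classLT_iff]
  have hmul : ∀ x, 0 < x → x < ω_ ζ → x * ω_ ζ = ω_ ζ := fun x hx hx' =>
    Ordinal.isPrincipal_mul_iff_mul_left_eq.1 hprin x hx hx'
  rcases hγ.eq_or_lt with rfl | hγ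
  · simp only [le_refl, true_and, lt_irrefl, false_and, or_false]
    constructor
    · rintro ⟨-, h2⟩
      refine hβ.lt_of_ne ?_
      rintro rfl
      exact absurd h2 (not_le.2 (lt_mul_of_one_lt_right (mul_pos hpos hpos) hΩ))
    · intro h2
      refine ⟨(mul_pos hpos hpos).ne', ?_⟩
      obtain ⟨b, hb, hlt⟩ := (Ordinal.lt_mul_iff_of_isSuccLimit hlim).1 h2
      rcases eq_or_ne b 0 with rfl | hb0
      · simp at hlt
      calc β * ω_ ζ ≤ ω_ ζ * b * ω_ ζ := mul_le_mul_left hlt.le _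
        _ = ω_ ζ * (b * ω_ ζ) := mul_assoc _ _ _
        _ = ω_ ζ * ω_ ζ := by rw [hmul b (pos_iff_ne_zero.2 hb0) hb]
  · simp only [not_le.2 hγ, false_and, false_or, hγ, true_and]
    constructor
    · rintro ⟨-, h2⟩
      by_contra! hcon
      exact absurd (h2.trans_lt hγ) (not_lt.2 (mul_le_mul_left hcon _))
    · intro hlt
      refine ⟨(hpos.trans_le (h hlt)).ne', ?_⟩
      rcases eq_or_ne β 0 with rfl | hβ0
      · simp
      · rw [hmul β (pos_iff_ne_zero.2 hβ0) hlt]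
        exact h hlt

end

/-! ### Order types pulled back along injections -/

theorem pullType_le {A : Type u} {α : Ordinal.{u}} (g : A ↪ Set.Iio α) : pullType g ≤ α := by
  let := pullLT_isWellOrder g
  refine le_of_le_of_eq ?_ (Ordinal.type_toType α)
  refine Ordinal.type_le_iff'.2 ⟨⟨g.trans Ordinal.ToType.mk.toEmbedding, ?_⟩⟩
  intro a b
  exact Ordinal.ToType.mk.lt_iff_lt

theorem card_pullType {A : Type u} {α : Ordinal.{u}} (g : A ↪ Set.Iio α) :
    (pullType g).card = #A := rfl

end OrdArith

/-! ### Truth of the modalities in terms of cardinals -/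

namespace KripkeModel

open OrdArith

variable {P : Type v} (M : KripkeModel.{u, v} P)

/-- The number of successors of `t` in `X`. -/
def count (t : M.World) (X : Set M.World) : Cardinal.{u} := #{w : M.World // M.R t w ∧ w ∈ X}

/-- The number of two-step paths from `s` that end in `X`. -/
def pairs (s : M.World) (X : Set M.World) : Cardinal.{u} :=
  #{q : M.World × M.World // M.R s q.1 ∧ M.R q.1 q.2 ∧ q.2 ∈ X}

/-- The number of successors of `s` that have as many successors in `X` as there are two-step paths
from `s`. -/
def heavy (s : M.World) (X : Set M.World) : Cardinal.{u} :=
  #{t : M.World // M.R s t ∧ M.pairs s Set.univ ≤ M.count t X}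

theorem count_univ (s : M.World) : M.count s Set.univ = M.kap s := by
  simp [count, kap, succs, Set.coe_ofPred]

theorem Regular.isRegular_pairs {M : KripkeModel.{u, v} P} (hM : M.Regular) (s : M.World)
    (h : ℵ₀ ≤ M.pairs s Set.univ) : (M.pairs s Set.univ).IsRegular := by
  have := hM s
  simp only [pairs, Set.mem_univ, and_true] at h ⊢
  exact this h

theorem count_add_compl (s : M.World) (X : Set M.World) :
    M.count s X + M.count s Xᶜ = M.kap s := by
  rw [← count_univ, count, count, count]
  change #({w | M.R s w ∧ w ∈ X} : Set _) + #({w | M.R s w ∧ w ∈ Xᶜ} : Set _) =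
    #({w | M.R s w ∧ w ∈ Set.univ} : Set _)
  rw [← Cardinal.mk_union_of_disjoint]
  · congr 2
    ext w
    simp [← and_or_left, em]
  · rw [Set.disjoint_left]
    exact fun w h1 h2 => h2.2 h1.2

theorem count_eq_zero {s : M.World} {X : Set M.World} :
    M.count s X = 0 ↔ ∀ t, M.R s t → t ∉ X := by
  simp [count, Cardinal.mk_eq_zero_iff, isEmpty_subtype]

theorem pairs_eq_zero {s : M.World} {X : Set M.World} :
    M.pairs s X = 0 ↔ ∀ t w, M.R s t → M.R t w → w ∉ X := by
  simp only [pairs, Cardinal.mk_eq_zero_iff, isEmpty_subtype, Prod.forall, not_and]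

theorem pairs_eq_sum (s : M.World) (X : Set M.World) :
    M.pairs s X = Cardinal.sum fun t : M.succs s => M.count t X := by
  simp only [pairs, count, ← Cardinal.mk_sigma]
  exact Cardinal.mk_congr
    { toFun := fun q => ⟨⟨q.1.1, q.2.1⟩, ⟨q.1.2, q.2.2⟩⟩
      invFun := fun q => ⟨(q.1.1, q.2.1), q.1.2, q.2.2⟩ }

theorem pairs_eq_sum_live (s : M.World) (X : Set M.World) :
    M.pairs s X = Cardinal.sum fun t : M.liveSuccs s => M.count t X := by
  simp only [pairs, count, ← Cardinal.mk_sigma]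
  exact Cardinal.mk_congr
    { toFun := fun q => ⟨⟨q.1.1, q.2.1, _, q.2.2.1⟩, ⟨q.1.2, q.2.2⟩⟩
      invFun := fun q => ⟨(q.1.1, q.2.1), q.1.2.1, q.2.2⟩ }

theorem pairs_add_compl (s : M.World) (X : Set M.World) :
    M.pairs s X + M.pairs s Xᶜ = M.pairs s Set.univ := by
  simp_rw [pairs_eq_sum, ← Cardinal.sum_add_distrib', count_add_compl, count_univ]

theorem count_le_pairs {s t : M.World} (h : M.R s t) (X : Set M.World) :
    M.count t X ≤ M.pairs s X := by
  rw [pairs_eq_sum]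
  exact Cardinal.le_sum (fun t : M.succs s => M.count t X) ⟨t, h⟩

theorem lam_le_pairs (s : M.World) : M.lam s ≤ M.pairs s Set.univ := by
  choose g hg using fun t : M.liveSuccs s => t.2.2
  exact Cardinal.mk_le_of_injective
    (f := fun t : M.liveSuccs s =>
      (⟨(t.1, g t), t.2.1, hg t, trivial⟩ :
        {q : M.World × M.World // M.R s q.1 ∧ M.R q.1 q.2 ∧ q.2 ∈ Set.univ}))
    fun t t' h => Subtype.ext (congrArg (fun q => q.1.1) h)

/-- An infinite sum is the maximum of its terms. Thus a strict majority becomes a comparison with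
the total, a threshold that can be put into `C`. -/
theorem lt_iff_lt_add {a b : Cardinal.{u}} (h : ℵ₀ ≤ a + b) : b < a ↔ b < a + b := by
  constructor
  · exact fun hab => hab.trans_le le_self_add
  · intro hb
    by_contra! hcon
    have hb0 : ℵ₀ ≤ b := by
      by_contra! hb0
      exact absurd h (not_le.2 (Cardinal.add_lt_aleph0 (hcon.trans_lt hb0) hb0))
    rw [Cardinal.add_eq_right hb0 hcon] at hb
    exact lt_irrefl _ hb

variable {M}

theorem sat_box_iff (e : M.Enumeration) (φ : DTML P) (s : M.World) :
    Sat e (.box φ) s ↔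
      (ℵ₀ ≤ M.kap s ∧ M.count s {w | Sat e φ w}ᶜ < M.kap s) ∨
      (M.kap s < ℵ₀ ∧ M.count s {w | Sat e φ w}ᶜ = 0) := by
  rw [Sat]
  refine or_congr (and_congr_right fun h => ?_) (and_congr_right fun _ => ?_)
  · rw [← count_add_compl M s {w | Sat e φ w}] at h ⊢
    exact lt_iff_lt_add h
  · simp [count_eq_zero]

namespace Enumeration

variable (e : M.Enumeration) (s : M.World)

theorem card_hOn (X : Set M.World) (γ : Set.Iio (M.lam s).ord) :
    (e.hOn s X γ).card = M.count (e.f s γ) X := by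
  rw [hOn, card_pullType]
  exact Cardinal.mk_congr (Equiv.subtypeSubtypeEquivSubtypeInter _ _)

theorem card_transSum_hOn (X : Set M.World) : (transSum (e.hOn s X)).card = M.pairs s X := by
  rw [card_transSum _ (e.f s), pairs_eq_sum_live]
  congr 1
  ext i
  rw [card_hOn, Equiv.apply_symm_apply]

theorem card_transSum_h : (transSum (e.h s)).card = M.pairs s Set.univ := by
  rw [card_transSum _ (e.f s), pairs_eq_sum_live]
  congr 1
  ext i
  rw [count_univ, h, Cardinal.card_ord, Equiv.apply_symm_apply]

theorem hOn_le (X : Set M.World) (γ : Set.Iio (M.lam s).ord) :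
    e.hOn s X γ ≤ (M.pairs s Set.univ).ord := by
  refine (pullType_le _).trans (Cardinal.ord_le_ord.2 ?_)
  rw [← count_univ]
  exact M.count_le_pairs (e.f s γ).2.1 _

theorem mk_ord_le_hOn (X : Set M.World) (h : M.pairs s Set.univ ≠ 0) :
    #{i : M.liveSuccs s // (M.pairs s Set.univ).ord ≤ e.hOn s X ((e.f s).symm i)} =
      M.heavy s X := by
  have key : ∀ i : M.liveSuccs s, (M.pairs s Set.univ).ord ≤ e.hOn s X ((e.f s).symm i) ↔
      M.pairs s Set.univ ≤ M.count i X := by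
    intro i
    rw [Cardinal.ord_le, card_hOn, Equiv.apply_symm_apply]
  refine Cardinal.mk_congr
    { toFun := fun i => ⟨i.1.1, i.1.2.1, (key _).1 i.2⟩
      invFun := fun t => ⟨⟨t.1, t.2.1, ?_⟩, (key _).2 t.2.2⟩ }
  -- `heavy` ranges over all successors, but a dead one has count zero and could be heavy only if
  -- there were no two-step paths at all.
  by_contra! hcon
  refine h (le_antisymm (t.2.2.trans_eq ?_) bot_le)
  exact M.count_eq_zero.2 fun w hw => absurd hw (hcon w)

theorem transSum_hOn_le (X : Set M.World) :
    transSum (e.hOn s X) ≤ (M.pairs s Set.univ).ord * (M.pairs s Set.univ).ord :=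
  (partialSum_le_mul _ (e.hOn_le s X) _).trans
    (mul_le_mul_right (Cardinal.ord_le_ord.2 (M.lam_le_pairs s)) _)

theorem mul_self_le_transSum_hOn (hc : (M.pairs s Set.univ).IsRegular) (X : Set M.World) :
    (M.pairs s Set.univ).ord * (M.pairs s Set.univ).ord ≤ transSum (e.hOn s X) ↔
      M.pairs s Set.univ ≤ M.heavy s X := by
  rw [← e.mk_ord_le_hOn s X hc.ne_zero]
  constructor
  · contrapose!
    exact transSum_lt_mul_self hc (Cardinal.ord_le_ord.2 (M.lam_le_pairs s)) (e.f s) (e.hOn_le s X)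
  · exact mul_self_le_transSum hc (e.f s)

end Enumeration

theorem sat_boxbox_iff (hM : M.Regular) (e : M.Enumeration) (φ : DTML P) (s : M.World) :
    Sat e (.boxbox φ) s ↔
      (ℵ₀ ≤ M.pairs s Set.univ ∧
        ((M.pairs s Set.univ ≤ M.heavy s {w | Sat e φ w} ∧
            M.heavy s {w | Sat e φ w}ᶜ < M.pairs s Set.univ) ∨
          (M.heavy s {w | Sat e φ w} < M.pairs s Set.univ ∧
            M.pairs s {w | Sat e φ w}ᶜ < M.pairs s Set.univ))) ∨
      (M.pairs s Set.univ < ℵ₀ ∧ M.pairs s {w | Sat e φ w}ᶜ = 0) := by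
  rw [Sat, e.card_transSum_h]
  refine or_congr ?_ (and_congr_right fun _ => ?_)
  swap
  · simp [pairs_eq_zero]
  rw [← Cardinal.mem_range_aleph_iff, Set.mem_range, ← exists_and_right]
  refine exists_congr fun ζ => ?_
  rw [eq_comm (a := ℵ_ ζ)]
  refine and_congr_right fun hζ => ?_
  have hc := hM.isRegular_pairs s (hζ ▸ Cardinal.aleph0_le_aleph ζ)
  have hord : ω_ ζ = (M.pairs s Set.univ).ord := by rw [hζ, Cardinal.ord_aleph]
  have hlt : ∀ X, transSum (e.hOn s X) < (M.pairs s Set.univ).ord ↔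
      M.pairs s X < M.pairs s Set.univ := by
    intro X
    rw [Cardinal.lt_ord, e.card_transSum_hOn]
  have hcompl : {w | ¬ Sat e φ w} = {w | Sat e φ w}ᶜ := rfl
  rw [hcompl, classLT_of_le_mul_self, hord, ← not_le, ← not_le, ← not_le, ← not_le,
    e.mul_self_le_transSum_hOn s hc, e.mul_self_le_transSum_hOn s hc, not_le, not_le, not_le, hlt]
  · rw [hord]
    exact e.transSum_hOn_le s _
  · rw [hord]
    exact e.transSum_hOn_le s _
  -- The paths ending in the truth set and in its complement together number `c`, so they cannot
  -- both number fewer than `c`.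
  · rw [hord, hlt, Cardinal.ord_le, e.card_transSum_hOn]
    intro h
    by_contra! hcon
    exact absurd (M.pairs_add_compl s {w | Sat e φ w})
      (Cardinal.add_lt_of_lt hc.aleph0_le hcon h).ne

end KripkeModel

/-! ### Collapsing cardinals to finitely many alephs -/

namespace CardinalCollapse

open Classical in
/-- The map on cardinals that fixes the finite cardinals and maps an infinite cardinal `c` to
`ℵ_ n`, where `n` is the number of elements of `C` that are at most `c`. -/
noncomputable def collapse (C : Finset Cardinal.{u}) (c : Cardinal.{u}) : Cardinal.{u} :=
  if c < ℵ₀ then c else ℵ_ ((C.filter (· ≤ c)).card : Ordinal.{u})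

variable {C : Finset Cardinal.{u}} {a b c : Cardinal.{u}}

theorem collapse_of_lt (h : c < ℵ₀) : collapse C c = c := if_pos h

theorem aleph0_le_collapse (h : ℵ₀ ≤ c) : ℵ₀ ≤ collapse C c := by
  rw [collapse, if_neg (not_lt.2 h)]
  exact Cardinal.aleph0_le_aleph _

theorem collapse_lt_aleph0_iff : collapse C c < ℵ₀ ↔ c < ℵ₀ := by
  refine ⟨fun h => ?_, fun h => by rwa [collapse_of_lt h]⟩
  by_contra! hcon
  exact absurd h (not_lt.2 (aleph0_le_collapse hcon))

theorem aleph0_le_collapse_iff : ℵ₀ ≤ collapse C c ↔ ℵ₀ ≤ c := by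
  rw [← not_lt, collapse_lt_aleph0_iff, not_lt]

theorem collapse_zero : collapse C 0 = 0 := collapse_of_lt Cardinal.aleph0_pos

theorem collapse_eq_zero_iff : collapse C c = 0 ↔ c = 0 := by
  refine ⟨fun h => ?_, fun h => by rw [h, collapse_zero]⟩
  have hc : collapse C c < ℵ₀ := h ▸ Cardinal.aleph0_pos
  rwa [collapse_of_lt (collapse_lt_aleph0_iff.1 hc)] at h

theorem collapse_mono : Monotone (collapse C) := by
  classical
  intro a b hab
  rcases lt_or_ge b ℵ₀ with hb | hb
  · rwa [collapse_of_lt hb, collapse_of_lt (hab.trans_lt hb)]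
  · rcases lt_or_ge a ℵ₀ with ha | ha
    · rw [collapse_of_lt ha]
      exact ha.le.trans (aleph0_le_collapse hb)
    · rw [collapse, collapse, if_neg (not_lt.2 ha), if_neg (not_lt.2 hb), Cardinal.aleph_le_aleph]
      exact_mod_cast Finset.card_le_card
        (Finset.monotone_filter_right C fun _ _ (hc : _ ≤ a) => hc.trans hab)

/-- Only the larger side has to be in `C`: for infinite `a < b`, the element `b` is itself counted
for `b` and not for `a`. -/
theorem collapse_lt_collapse_iff (hb : b ∈ C) (hb0 : ℵ₀ ≤ b) :
    collapse C a < collapse C b ↔ a < b := by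
  classical
  refine ⟨collapse_mono.reflect_lt, fun hab => ?_⟩
  rcases lt_or_ge a ℵ₀ with ha | ha
  · rw [collapse_of_lt ha]
    exact ha.trans_le (aleph0_le_collapse hb0)
  · rw [collapse, collapse, if_neg (not_lt.2 ha), if_neg (not_lt.2 hb0), Cardinal.aleph_lt_aleph]
    norm_cast
    refine Finset.card_lt_card
      ⟨Finset.monotone_filter_right C fun _ _ (hc : _ ≤ a) => hc.trans hab.le, ?_⟩
    intro h
    exact absurd (Finset.mem_filter.1 (h (Finset.mem_filter.2 ⟨hb, le_rfl⟩))).2 (not_le.2 hab)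

theorem collapse_le_collapse_iff (ha : a ∈ C) (ha0 : ℵ₀ ≤ a) :
    collapse C a ≤ collapse C b ↔ a ≤ b := by
  rw [← not_lt, collapse_lt_collapse_iff ha ha0, not_lt]

theorem collapse_le (c : Cardinal.{u}) : collapse C c ≤ ℵ_ (C.card : Ordinal.{u}) := by
  classical
  rw [collapse]
  split_ifs with h
  · exact h.le.trans (Cardinal.aleph0_le_aleph _)
  · rw [Cardinal.aleph_le_aleph]
    exact_mod_cast Finset.card_filter_le _ _

/-- Infinite addition is a maximum, which monotone maps preserve; on finite cardinals the collapse
is the identity. -/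
theorem collapse_add (a b : Cardinal.{u}) : collapse C (a + b) = collapse C a + collapse C b := by
  wlog hab : a ≤ b generalizing a b
  · rw [add_comm a, add_comm (collapse C a)]
    exact this b a (le_of_not_ge hab)
  rcases lt_or_ge b ℵ₀ with hb | hb
  · have ha := hab.trans_lt hb
    rw [collapse_of_lt ha, collapse_of_lt hb, collapse_of_lt (Cardinal.add_lt_aleph0 ha hb)]
  · rw [Cardinal.add_eq_right hb hab,
      Cardinal.add_eq_right (aleph0_le_collapse hb) (collapse_mono hab)]

theorem collapse_mul (a b : Cardinal.{u}) : collapse C (a * b) = collapse C a * collapse C b := by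
  wlog hab : a ≤ b generalizing a b
  · rw [mul_comm a, mul_comm (collapse C a)]
    exact this b a (le_of_not_ge hab)
  rcases eq_or_ne a 0 with rfl | ha0
  · simp [collapse_zero]
  rcases lt_or_ge b ℵ₀ with hb | hb
  · have ha := hab.trans_lt hb
    rw [collapse_of_lt ha, collapse_of_lt hb, collapse_of_lt (Cardinal.mul_lt_aleph0 ha hb)]
  · rw [Cardinal.mul_eq_right hb hab ha0, Cardinal.mul_eq_right (aleph0_le_collapse hb)
      (collapse_mono hab) (collapse_eq_zero_iff.not.2 ha0)]

theorem sum_equiv {ι κ : Type u} (e : ι ≃ κ) (f : κ → Cardinal.{u}) :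
    (Cardinal.sum fun i => f (e i)) = Cardinal.sum f :=
  Cardinal.mk_congr (Equiv.sigmaCongrLeft (β := fun i => (f i).out) e)

theorem sum_sigma {ι : Type u} {κ : ι → Type u} (f : ι → Cardinal.{u}) :
    (Cardinal.sum fun x : Σ i, κ i => f x.1) = Cardinal.sum fun i => #(κ i) * f i := by
  have := Cardinal.mk_congr (Equiv.sigmaAssoc fun i (_ : κ i) => (f i).out)
  simpa using this

theorem sum_option {ι : Type u} (f : Option ι → Cardinal.{u}) :
    Cardinal.sum f = f none + Cardinal.sum fun i => f (some i) := by
  refine Eq.trans (Cardinal.mk_congr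
    (α := Σ i, (f i).out) (β := (f none).out ⊕ Σ i, (f (some i)).out)
    { toFun := fun
        | ⟨none, x⟩ => Sum.inl x
        | ⟨some i, x⟩ => Sum.inr ⟨i, x⟩
      invFun := fun
        | Sum.inl x => ⟨none, x⟩
        | Sum.inr ⟨i, x⟩ => ⟨some i, x⟩
      left_inv := by rintro ⟨_ | i, x⟩ <;> rfl
      right_inv := by rintro (x | ⟨i, x⟩) <;> rfl }) ?_
  simp

theorem sum_eq_finset_sum {ι : Type u} [Fintype ι] (f : ι → Cardinal.{u}) :
    Cardinal.sum f = ∑ i, f i := by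
  refine Fintype.induction_empty_option
    (P := fun ι _ => ∀ f : ι → Cardinal.{u}, Cardinal.sum f = ∑ i, f i) ?_ ?_ ?_ ι f
  · intro α β _ e ih f
    let := Fintype.ofEquiv β e.symm
    rw [← sum_equiv e, ih, Equiv.sum_comp]
  · intro f
    simp [Cardinal.sum]
  · intro α _ ih f
    rw [sum_option, ih, Fintype.sum_option]

theorem collapse_sum {ι : Type u} [Finite ι] (f : ι → Cardinal.{u}) :
    collapse C (Cardinal.sum f) = Cardinal.sum fun i => collapse C (f i) := by
  have := Fintype.ofFinite ι
  rw [sum_eq_finset_sum, sum_eq_finset_sum]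
  exact map_sum (⟨⟨collapse C, collapse_zero⟩, collapse_add⟩ : Cardinal →+ Cardinal) f
    Finset.univ

/-- A finite sum of cardinals below an infinite cardinal stays below it. -/
theorem sum_lt_of_finite {ι : Type u} [Finite ι] (hc : ℵ₀ ≤ c) (f : ι → Cardinal.{u})
    (h : ∀ i, f i < c) : Cardinal.sum f < c := by
  have := Fintype.ofFinite ι
  rw [sum_eq_finset_sum]
  exact Finset.sum_induction f (· < c) (fun _ _ => Cardinal.add_lt_of_lt hc)
    (Cardinal.aleph0_pos.trans_le hc) fun i _ => h i

end CardinalCollapse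

namespace KripkeModel

open CardinalCollapse

variable {P : Type v} (M : KripkeModel.{u, v} P) (𝓧 : Set (Set M.World))

/-! ### Finitely many classes of successors -/

/-- The information about a successor `t` of `s` that matters for the truth of boxed formulas at
`s` whose immediate subformula has its truth set in `𝓧`. -/
def profile (s t : M.World) (X : 𝓧) : Prop × Prop × Prop :=
  (t ∈ X.1, M.pairs s Set.univ ≤ M.count t X, M.count t X = 0)

/-- Successors of `s` up to equality of profiles. -/
def SuccClass (s : M.World) : Type u :=
  Quotient (Setoid.ker fun t : M.succs s => M.profile 𝓧 s t)

variable {M 𝓧}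

namespace SuccClass

variable {s : M.World}

instance [Finite 𝓧] : Finite (M.SuccClass 𝓧 s) :=
  Finite.of_equiv _ (Setoid.quotientKerEquivRange fun t : M.succs s => M.profile 𝓧 s t).symm

/-- The class of a successor. -/
def of (t : M.succs s) : M.SuccClass 𝓧 s := Quotient.mk _ t

/-- A representative of a class. -/
noncomputable def rep (c : M.SuccClass 𝓧 s) : M.World := (Quotient.out c).1

/-- The number of elements of a class. -/
noncomputable def mult (c : M.SuccClass 𝓧 s) : Cardinal.{u} := #{t : M.succs s // of t = c}

theorem rel_rep (c : M.SuccClass 𝓧 s) : M.R s c.rep := (Quotient.out c).2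

theorem of_rep (c : M.SuccClass 𝓧 s) : of ⟨c.rep, c.rel_rep⟩ = c := Quotient.out_eq c

theorem rep_injective : Function.Injective (rep : M.SuccClass 𝓧 s → M.World) := by
  intro c c' h
  rw [← of_rep c, ← of_rep c']
  congr

theorem mult_ne_zero (c : M.SuccClass 𝓧 s) : c.mult ≠ 0 :=
  Cardinal.mk_ne_zero_iff.2 ⟨⟨_, c.of_rep⟩⟩

theorem profile_rep (t : M.succs s) : M.profile 𝓧 s (of (𝓧 := 𝓧) t).rep = M.profile 𝓧 s t :=
  Quotient.mk_out (s := Setoid.ker fun t : M.succs s => M.profile 𝓧 s t) t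

theorem rep_mem {X : Set M.World} (hX : X ∈ 𝓧) (t : M.succs s) :
    (of (𝓧 := 𝓧) t).rep ∈ X ↔ t.1 ∈ X :=
  iff_of_eq (congrArg Prod.fst (congrFun (profile_rep t) ⟨X, hX⟩))

theorem pairs_le_count_rep {X : Set M.World} (hX : X ∈ 𝓧) (t : M.succs s) :
    M.pairs s Set.univ ≤ M.count (of (𝓧 := 𝓧) t).rep X ↔
    M.pairs s Set.univ ≤ M.count t X :=
  iff_of_eq (congrArg (fun x => x.2.1) (congrFun (profile_rep t) ⟨X, hX⟩))

theorem count_rep_eq_zero {X : Set M.World} (hX : X ∈ 𝓧) (t : M.succs s) :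
    M.count (of (𝓧 := 𝓧) t).rep X = 0 ↔ M.count t X = 0 :=
  iff_of_eq (congrArg (fun x => x.2.2) (congrFun (profile_rep t) ⟨X, hX⟩))

end SuccClass

open SuccClass

variable {s : M.World}

/-- A property constant on classes holds on a union of whole classes, so its extent is a sum of
multiplicities. -/
theorem mk_succs_eq_sum (p : M.World → Prop)
    (hp : ∀ t : M.succs s, p (of (𝓧 := 𝓧) t).rep ↔ p t) :
    #{t : M.World // M.R s t ∧ p t} =
      Cardinal.sum fun c : {c : M.SuccClass 𝓧 s // p c.rep} => c.1.mult := by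
  simp only [mult, ← Cardinal.mk_sigma]
  exact Cardinal.mk_congr
    { toFun := fun t => ⟨⟨of ⟨t.1, t.2.1⟩, (hp ⟨t.1, t.2.1⟩).2 t.2.2⟩, ⟨t.1, t.2.1⟩, rfl⟩
      invFun := fun x => ⟨x.2.1.1, x.2.1.2, by
        have := x.1.2
        rw [← x.2.2] at this
        exact (hp _).1 this⟩
      left_inv := fun t => rfl
      right_inv := by
        rintro ⟨⟨c, hc⟩, ⟨t, ht⟩⟩
        change of t = c at ht
        subst ht
        rfl }

theorem count_eq_sum {X : Set M.World} (hX : X ∈ 𝓧) :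
    M.count s X = Cardinal.sum fun c : {c : M.SuccClass 𝓧 s // c.rep ∈ X} => c.1.mult :=
  mk_succs_eq_sum (· ∈ X) (rep_mem hX)

theorem heavy_eq_sum {X : Set M.World} (hX : X ∈ 𝓧) :
    M.heavy s X = Cardinal.sum
      fun c : {c : M.SuccClass 𝓧 s // M.pairs s Set.univ ≤ M.count c.rep X} => c.1.mult :=
  mk_succs_eq_sum (fun t => M.pairs s Set.univ ≤ M.count t X) (pairs_le_count_rep hX)

variable (𝓧 s) in
/-- The number of two-step paths from `s` to `X` after replacing all successors of `s` by the
representatives of their classes. -/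
noncomputable def repPairs (X : Set M.World) : Cardinal.{u} :=
  Cardinal.sum fun c : M.SuccClass 𝓧 s => c.mult * M.count c.rep X

/-- The profile records whether a successor sees `X`; if the representative does, each member of the
class starts its own path into `X`. -/
theorem mult_le_pairs {X : Set M.World} (hX : X ∈ 𝓧) (c : M.SuccClass 𝓧 s)
    (hc : M.count c.rep X ≠ 0) : c.mult ≤ M.pairs s X := by
  have h : ∀ t : {t : M.succs s // of t = c}, ∃ w, M.R t.1.1 w ∧ w ∈ X := by
    rintro ⟨t, rfl⟩
    rw [Ne, count_rep_eq_zero hX, count_eq_zero] at hc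
    push Not at hc
    exact hc
  choose g hg using h
  exact Cardinal.mk_le_of_injective
    (f := fun t : {t : M.succs s // of t = c} =>
      (⟨(t.1.1, g t), t.1.2, hg t⟩ :
        {q : M.World × M.World // M.R s q.1 ∧ M.R q.1 q.2 ∧ q.2 ∈ X}))
    fun t t' h => Subtype.ext (Subtype.ext (congrArg (fun q => q.1.1) h))

theorem repPairs_eq_zero {X : Set M.World} (hX : X ∈ 𝓧) :
    repPairs 𝓧 s X = 0 ↔ M.pairs s X = 0 := by
  have h1 : repPairs 𝓧 s X = 0 ↔ ∀ c : M.SuccClass 𝓧 s, M.count c.rep X = 0 := by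
    constructor
    · intro h c
      have := (Cardinal.le_sum (fun c : M.SuccClass 𝓧 s => c.mult * M.count c.rep X) c).trans_eq h
      exact (mul_eq_zero.1 (le_antisymm this bot_le)).resolve_left c.mult_ne_zero
    · intro h
      simp [repPairs, h]
  rw [h1, pairs_eq_zero]
  constructor
  · intro h t w ht
    exact M.count_eq_zero.1 ((count_rep_eq_zero hX ⟨t, ht⟩).1 (h _)) w
  · exact fun h c => M.count_eq_zero.2 fun w => h _ w c.rel_rep

variable [Finite 𝓧]

theorem repPairs_lt_aleph0 {X : Set M.World} (hX : X ∈ 𝓧) (h : M.pairs s X < ℵ₀) :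
    repPairs 𝓧 s X < ℵ₀ := by
  refine sum_lt_of_finite le_rfl _ fun c => ?_
  rcases eq_or_ne (M.count c.rep X) 0 with hc | hc
  · rw [hc, mul_zero]
    exact Cardinal.aleph0_pos
  · exact Cardinal.mul_lt_aleph0 ((mult_le_pairs hX c hc).trans_lt h)
      ((M.count_le_pairs c.rel_rep X).trans_lt h)

theorem repPairs_lt_pairs_iff (hs : (M.pairs s Set.univ).IsRegular) {X : Set M.World}
    (hX : X ∈ 𝓧) :
    repPairs 𝓧 s X < M.pairs s Set.univ ↔ M.pairs s X < M.pairs s Set.univ := by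
  constructor
  · intro h
    have hle : ∀ c : M.SuccClass 𝓧 s, c.mult * M.count c.rep X < M.pairs s Set.univ := fun c =>
      (Cardinal.le_sum (fun c : M.SuccClass 𝓧 s => c.mult * M.count c.rep X) c).trans_lt h
    rw [pairs_eq_sum_live]
    have : (Cardinal.sum fun t : M.liveSuccs s => M.count t X) =
        Cardinal.sum fun t : {t : M.succs s // M.count t X ≠ 0} => M.count t X := by
      rw [← pairs_eq_sum_live]
      simp only [pairs, count, ← Cardinal.mk_sigma]
      exact Cardinal.mk_congr
        { toFun := fun q => ⟨⟨⟨q.1.1, q.2.1⟩, Cardinal.mk_ne_zero_iff.2 ⟨⟨_, q.2.2⟩⟩⟩, ⟨_, q.2.2⟩⟩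
          invFun := fun q => ⟨(q.1.1.1, q.2.1), q.1.1.2, q.2.2⟩ }
    rw [this]
    -- Regularity needs two bounds: the successors that see `X` fill finitely many classes of size
    -- below the threshold, and no single count reaches the threshold, since its representative's
    -- count would too.
    refine Cardinal.sum_lt_of_isRegular hs ?_ fun t => ?_
    · have : #{t : M.succs s // M.count t X ≠ 0} =
          #{t : M.World // M.R s t ∧ M.count t X ≠ 0} :=
        Cardinal.mk_congr (Equiv.subtypeSubtypeEquivSubtypeInter _ (fun t => M.count t X ≠ 0))
      rw [this, mk_succs_eq_sum (𝓧 := 𝓧) (fun t => M.count t X ≠ 0)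
        fun t => (count_rep_eq_zero hX t).not]
      refine sum_lt_of_finite hs.aleph0_le _ fun c => lt_of_le_of_lt ?_ (hle c.1)
      exact le_mul_of_one_le_right' (Cardinal.one_le_iff_ne_zero.2 c.2)
    · by_contra! hcon
      refine absurd (hle (of t.1)) (not_lt.2 ?_)
      exact ((pairs_le_count_rep hX t.1).2 hcon).trans
        (le_mul_of_one_le_left' (Cardinal.one_le_iff_ne_zero.2 (mult_ne_zero _)))
  · intro h
    refine sum_lt_of_finite hs.aleph0_le _ fun c => ?_
    rcases eq_or_ne (M.count c.rep X) 0 with hc | hc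
    · rw [hc, mul_zero]
      exact hs.pos
    · exact Cardinal.mul_lt_of_lt hs.aleph0_le ((mult_le_pairs hX c hc).trans_lt h)
        ((M.count_le_pairs c.rel_rep X).trans_lt h)

theorem repPairs_univ (hs : (M.pairs s Set.univ).IsRegular) (h𝓧 : Set.univ ∈ 𝓧) :
    repPairs 𝓧 s Set.univ = M.pairs s Set.univ := by
  refine le_antisymm ?_ (not_lt.1 ((repPairs_lt_pairs_iff hs h𝓧).not.2 (lt_irrefl _)))
  -- Passing to the successor cardinal turns the weak bound on finitely many terms into the strict
  -- one of `sum_lt_of_finite`.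
  rw [← Order.lt_succ_iff]
  refine sum_lt_of_finite (hs.aleph0_le.trans (Order.le_succ _)) _ fun c => ?_
  rw [Order.lt_succ_iff]
  rcases eq_or_ne (M.count c.rep Set.univ) 0 with hc | hc
  · rw [hc, mul_zero]
    exact bot_le
  · exact Cardinal.mul_le_of_le hs.aleph0_le (mult_le_pairs h𝓧 c hc)
      (M.count_le_pairs c.rel_rep _)

end KripkeModel

namespace KripkeModel

open CardinalCollapse SuccClass

variable {P : Type v} (M : KripkeModel.{u, v} P) (𝓧 : Set (Set M.World))

/-! ### The collapsed model -/

/-- The worlds that are reached from `s₀` in `i` steps along representatives. -/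
def layer (s₀ : M.World) : ℕ → Set M.World
  | 0 => {s₀}
  | i + 1 => ⋃ s ∈ layer s₀ i, Set.range (rep : M.SuccClass 𝓧 s → M.World)

theorem finite_layer [Finite 𝓧] (s₀ : M.World) (i : ℕ) : (M.layer 𝓧 s₀ i).Finite := by
  induction i with
  | zero => exact Set.finite_singleton _
  | succ i ih => exact ih.biUnion fun _ _ => Set.finite_range _

/-- The nodes of the collapsed model: pairs of a depth and a world reached at this depth. -/
def Node (s₀ : M.World) (d : ℕ) : Type u :=
  {p : ULift.{u} (Fin (d + 1)) × M.World // p.2 ∈ M.layer 𝓧 s₀ p.1.down}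

variable {M 𝓧} {s₀ : M.World} {d : ℕ}

/-- The depth of a node. -/
def Node.depth (p : M.Node 𝓧 s₀ d) : ℕ := p.1.1.down

/-- The world at a node. -/
def Node.world (p : M.Node 𝓧 s₀ d) : M.World := p.1.2

theorem Node.world_mem (p : M.Node 𝓧 s₀ d) : p.world ∈ M.layer 𝓧 s₀ p.depth := p.2

theorem Node.ext {p q : M.Node 𝓧 s₀ d} (h1 : p.depth = q.depth) (h2 : p.world = q.world) :
    p = q :=
  Subtype.ext (Prod.ext (ULift.ext _ _ (Fin.ext h1)) h2)

instance [Finite 𝓧] : Finite (M.Node 𝓧 s₀ d) := by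
  have : Finite (Σ i : Fin (d + 1), M.layer 𝓧 s₀ i) := by
    have := fun i : Fin (d + 1) => (M.finite_layer 𝓧 s₀ i).to_subtype
    infer_instance
  refine Finite.of_injective
    (fun p : M.Node 𝓧 s₀ d => (⟨p.1.1.down, p.1.2, p.2⟩ : Σ i : Fin (d + 1), M.layer 𝓧 s₀ i)) ?_
  rintro ⟨⟨⟨i⟩, s⟩, hp⟩ ⟨⟨⟨j⟩, t⟩, hq⟩ h
  simp only [Sigma.mk.injEq] at h
  obtain ⟨rfl, h⟩ := h
  simp only [heq_eq_eq, Subtype.mk.injEq] at h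
  subst h
  rfl

/-- The node of a representative below a node. -/
noncomputable def Node.child (p : M.Node 𝓧 s₀ d) (hp : p.depth < d) (c : M.SuccClass 𝓧 p.world) :
    M.Node 𝓧 s₀ d :=
  ⟨(⟨⟨p.depth + 1, Nat.succ_lt_succ hp⟩⟩, c.rep),
    Set.mem_biUnion p.world_mem (Set.mem_range_self c)⟩

/-- A set of labels that can be used to make copies of nodes. -/
abbrev Label (C : Finset Cardinal.{u}) : Type u := (ℵ_ (C.card : Ordinal.{u})).out

theorem exists_labels (C : Finset Cardinal.{u}) (c : Cardinal.{u}) :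
    ∃ D : Set (Label C), #D = collapse C c :=
  Cardinal.le_mk_iff_exists_set.1 ((collapse_le c).trans_eq (Cardinal.mk_out _).symm)

/-- A set of labels with `collapse C c` elements. -/
noncomputable def labels (C : Finset Cardinal.{u}) (c : Cardinal.{u}) : Set (Label C) :=
  (exists_labels C c).choose

theorem mk_labels (C : Finset Cardinal.{u}) (c : Cardinal.{u}) :
    #(labels C c) = collapse C c :=
  (exists_labels C c).choose_spec

variable (M 𝓧 s₀ d) in
/-- The collapsed model: each representative of a class of successors is copied as often as the
collapsed cardinal of the class says. -/
def collapsed (C : Finset Cardinal.{u}) : KripkeModel.{u, v} P where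
  World := M.Node 𝓧 s₀ d × Label C
  nonempty := ⟨⟨⟨(⟨0⟩, s₀), rfl⟩,
    (Cardinal.mk_ne_zero_iff.1 (by simp [(Cardinal.aleph_pos _).ne'])).some⟩⟩
  -- The label of `x` plays no role: copies of a node share their successors, while two-step paths
  -- are still counted separately by their middle world.
  R x y := y.1.depth = x.1.depth + 1 ∧
    ∃ c : M.SuccClass 𝓧 x.1.world, y.1.world = c.rep ∧ y.2 ∈ labels C c.mult
  V p := {x | x.1.world ∈ M.V p}

variable {C : Finset Cardinal.{u}}

theorem mk_collapsed_lt [Finite 𝓧] :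
    #(M.collapsed 𝓧 s₀ d C).World < ℵ_ (ω : Ordinal.{u}) := by
  change #(M.Node 𝓧 s₀ d × Label C) < _
  rw [Cardinal.mk_prod, Cardinal.lift_id, Cardinal.lift_id, Cardinal.mk_out]
  refine Cardinal.mul_lt_of_lt (Cardinal.aleph0_le_aleph _)
    ((Cardinal.lt_aleph0_of_finite _).trans_le (Cardinal.aleph0_le_aleph _)) ?_
  rw [Cardinal.aleph_lt_aleph]
  exact Ordinal.natCast_lt_omega0 _

theorem regular_of_mk_lt {N : KripkeModel.{u, v} P} (h : #N.World < ℵ_ (ω : Ordinal.{u})) :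
    N.Regular := by
  intro s hs
  have hlt : #{q : N.World × N.World // N.R s q.1 ∧ N.R q.1 q.2} < ℵ_ (ω : Ordinal.{u}) := by
    refine (Cardinal.mk_subtype_le _).trans_lt ?_
    rw [Cardinal.mk_prod, Cardinal.lift_id]
    exact Cardinal.mul_lt_of_lt (Cardinal.aleph0_le_aleph _) h h
  obtain ⟨o, ho⟩ := Cardinal.mem_range_aleph_iff.2 hs
  rw [← ho] at hlt ⊢
  obtain ⟨n, rfl⟩ := Ordinal.lt_omega0.1 (Cardinal.aleph_lt_aleph.1 hlt)
  cases n with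
  | zero =>
    rw [Nat.cast_zero, Cardinal.aleph_zero]
    exact Cardinal.isRegular_aleph0
  | succ n =>
    rw [Nat.cast_succ]
    exact Cardinal.isRegular_aleph_add_one _

/-- The successors of a world of the collapsed model. -/
noncomputable def succsCollapsedEquiv (x : (M.collapsed 𝓧 s₀ d C).World) (hx : x.1.depth < d) :
    (Σ c : M.SuccClass 𝓧 x.1.world, labels C c.mult) ≃ (M.collapsed 𝓧 s₀ d C).succs x :=
  Equiv.ofBijective
    (fun y => ⟨(x.1.child hx y.1, y.2.1), rfl, y.1, rfl, y.2.2⟩) <| by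
    constructor
    · rintro ⟨c, k, hk⟩ ⟨c', k', hk'⟩ h
      have h := congrArg Subtype.val h
      obtain rfl : c = c' := rep_injective (congrArg (fun z => z.1.world) h)
      obtain rfl : k = k' := congrArg Prod.snd h
      rfl
    · rintro ⟨⟨q, k⟩, h1, c, h2, h3⟩
      refine ⟨⟨c, k, h3⟩, Subtype.ext (Prod.ext (Node.ext ?_ ?_) rfl)⟩
      · exact h1.symm
      · exact h2.symm

theorem mk_succs_collapsed (x : (M.collapsed 𝓧 s₀ d C).World) (hx : x.1.depth < d)
    (p : (M.collapsed 𝓧 s₀ d C).World → Prop) (q : M.World → Prop)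
    (hpq : ∀ y : (M.collapsed 𝓧 s₀ d C).World, y.1.depth = x.1.depth + 1 → (p y ↔ q y.1.world)) :
    #{y : (M.collapsed 𝓧 s₀ d C).World // (M.collapsed 𝓧 s₀ d C).R x y ∧ p y} =
      Cardinal.sum fun c : {c : M.SuccClass 𝓧 x.1.world // q c.rep} => collapse C c.1.mult := by
  simp only [← mk_labels, ← Cardinal.mk_sigma]
  refine Cardinal.mk_congr (((Equiv.subtypeSubtypeEquivSubtypeInter _ p).symm.trans
    ((succsCollapsedEquiv x hx).subtypeEquiv ?_).symm).trans
      (Equiv.subtypeSigmaEquiv _ fun c : M.SuccClass 𝓧 x.1.world => q c.rep))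
  exact fun y => (hpq (succsCollapsedEquiv x hx y).1 rfl).symm

variable [Finite 𝓧]

theorem count_collapsed (x : (M.collapsed 𝓧 s₀ d C).World) (hx : x.1.depth < d)
    {X : Set M.World} (hX : X ∈ 𝓧) {Y : Set (M.collapsed 𝓧 s₀ d C).World}
    (hY : ∀ y : (M.collapsed 𝓧 s₀ d C).World, y.1.depth = x.1.depth + 1 →
      (y ∈ Y ↔ y.1.world ∈ X)) :
    (M.collapsed 𝓧 s₀ d C).count x Y = collapse C (M.count x.1.world X) := by
  rw [count_eq_sum hX, collapse_sum]
  exact mk_succs_collapsed x hx (· ∈ Y) (· ∈ X) hY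

theorem kap_collapsed (h𝓧 : Set.univ ∈ 𝓧) (x : (M.collapsed 𝓧 s₀ d C).World)
    (hx : x.1.depth < d) :
    (M.collapsed 𝓧 s₀ d C).kap x = collapse C (M.kap x.1.world) := by
  rw [← count_univ, ← count_univ]
  exact count_collapsed x hx h𝓧 fun _ _ => Iff.rfl

/-- All copies of a representative have the same count, so each class contributes a product, and the
collapse passes through products and the finite sum over classes. -/
theorem pairs_collapsed (x : (M.collapsed 𝓧 s₀ d C).World) (hx : x.1.depth + 1 < d)
    {X : Set M.World} (hX : X ∈ 𝓧) {Y : Set (M.collapsed 𝓧 s₀ d C).World}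
    (hY : ∀ y : (M.collapsed 𝓧 s₀ d C).World, y.1.depth = x.1.depth + 1 + 1 →
      (y ∈ Y ↔ y.1.world ∈ X)) :
    (M.collapsed 𝓧 s₀ d C).pairs x Y = collapse C (repPairs 𝓧 x.1.world X) := by
  have hx' : x.1.depth < d := (Nat.lt_succ_self _).trans hx
  have key : ∀ t : Σ c : M.SuccClass 𝓧 x.1.world, labels C c.mult,
      (M.collapsed 𝓧 s₀ d C).count (succsCollapsedEquiv x hx' t) Y =
        collapse C (M.count t.1.rep X) := fun t =>
    count_collapsed (succsCollapsedEquiv x hx' t).1 hx hX hY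
  rw [pairs_eq_sum, ← sum_equiv (succsCollapsedEquiv x hx'), repPairs, collapse_sum]
  simp only [key, collapse_mul]
  refine (sum_sigma fun c : M.SuccClass 𝓧 x.1.world => collapse C (M.count c.rep X)).trans ?_
  simp only [mk_labels]

theorem heavy_collapsed (x : (M.collapsed 𝓧 s₀ d C).World) (hx : x.1.depth + 1 < d)
    {X : Set M.World} (hX : X ∈ 𝓧) {Y : Set (M.collapsed 𝓧 s₀ d C).World}
    (hY : ∀ y : (M.collapsed 𝓧 s₀ d C).World, y.1.depth = x.1.depth + 1 + 1 →
      (y ∈ Y ↔ y.1.world ∈ X))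
    (hC : M.pairs x.1.world Set.univ ∈ C) (h0 : ℵ₀ ≤ M.pairs x.1.world Set.univ)
    (hpairs : (M.collapsed 𝓧 s₀ d C).pairs x Set.univ = collapse C (M.pairs x.1.world Set.univ)) :
    (M.collapsed 𝓧 s₀ d C).heavy x Y = collapse C (M.heavy x.1.world X) := by
  rw [heavy_eq_sum hX, collapse_sum]
  refine mk_succs_collapsed x ((Nat.lt_succ_self _).trans hx)
    (fun y => (M.collapsed 𝓧 s₀ d C).pairs x Set.univ ≤ (M.collapsed 𝓧 s₀ d C).count y Y)
    (fun t => M.pairs x.1.world Set.univ ≤ M.count t X) fun y hy => ?_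
  rw [hpairs, count_collapsed y (hy ▸ hx) hX (hy ▸ hY), collapse_le_collapse_iff hC h0]

/-! ### Truth in the collapsed model -/

/-- The modal depth of a formula. -/
def _root_.DTML.depth : DTML P → ℕ
  | .prop _ => 0
  | .neg φ => φ.depth
  | .conj φ ψ => max φ.depth ψ.depth
  | .box φ => φ.depth + 1
  | .boxbox φ => φ.depth + 2

/-- The truth sets of the subformulas of a formula, and their complements. -/
def truthSets (e : M.Enumeration) : DTML P → Set (Set M.World)
  | .prop p => {{w | Sat e (.prop p) w}, {w | Sat e (.prop p) w}ᶜ}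
  | .neg φ => {{w | Sat e (.neg φ) w}, {w | Sat e (.neg φ) w}ᶜ} ∪ truthSets e φ
  | .conj φ ψ => {{w | Sat e (.conj φ ψ) w}, {w | Sat e (.conj φ ψ) w}ᶜ} ∪
      (truthSets e φ ∪ truthSets e ψ)
  | .box φ => {{w | Sat e (.box φ) w}, {w | Sat e (.box φ) w}ᶜ} ∪ truthSets e φ
  | .boxbox φ => {{w | Sat e (.boxbox φ) w}, {w | Sat e (.boxbox φ) w}ᶜ} ∪ truthSets e φ

theorem finite_truthSets (e : M.Enumeration) (φ : DTML P) : (truthSets e φ).Finite := by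
  induction φ with
  | prop => simp [truthSets]
  | neg => simp_all [truthSets]
  | conj => simp_all [truthSets]
  | box => simp_all [truthSets]
  | boxbox => simp_all [truthSets]

theorem mem_truthSets (e : M.Enumeration) (φ : DTML P) :
    {w | Sat e φ w} ∈ truthSets e φ ∧ {w | Sat e φ w}ᶜ ∈ truthSets e φ := by
  cases φ <;> simp [truthSets]

/-- Nodes at depth `d` have no successors, so agreement is claimed only while the remaining depth
covers the modal depth of the formula. `C` need only contain the two totals at each node, the sole
thresholds in the truth conditions. -/
theorem sat_collapsed_iff (hM : M.Regular) (e : M.Enumeration)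
    (e' : (M.collapsed 𝓧 s₀ d C).Enumeration) (h𝓧 : Set.univ ∈ 𝓧)
    (hC : ∀ p : M.Node 𝓧 s₀ d, M.kap p.world ∈ C ∧ M.pairs p.world Set.univ ∈ C)
    (φ : DTML P) (hφ : truthSets e φ ⊆ 𝓧) (x : (M.collapsed 𝓧 s₀ d C).World)
    (hx : x.1.depth + φ.depth ≤ d) :
    Sat e' φ x ↔ Sat e φ x.1.world := by
  have hM' : (M.collapsed 𝓧 s₀ d C).Regular := regular_of_mk_lt mk_collapsed_lt
  induction φ generalizing x with
  | prop p => exact Iff.rfl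
  | neg φ ih => exact not_congr (ih (Set.subset_union_right.trans hφ) x hx)
  | conj φ ψ ih1 ih2 =>
    have h := Set.subset_union_right.trans hφ
    exact and_congr
      (ih1 (Set.subset_union_left.trans h) x
        ((Nat.add_le_add_left (le_max_left _ _) _).trans hx))
      (ih2 (Set.subset_union_right.trans h) x
        ((Nat.add_le_add_left (le_max_right _ _) _).trans hx))
  | box φ ih =>
    have h := Set.subset_union_right.trans hφ
    simp only [DTML.depth] at hx
    have hd : x.1.depth < d := by omega
    have hcount : (M.collapsed 𝓧 s₀ d C).count x {w | Sat e' φ w}ᶜ =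
        collapse C (M.count x.1.world {w | Sat e φ w}ᶜ) :=
      count_collapsed x hd (h (mem_truthSets e φ).2)
        fun y hy => not_congr (ih h y (by omega))
    rw [sat_box_iff, sat_box_iff, hcount, kap_collapsed h𝓧 x hd, aleph0_le_collapse_iff,
      collapse_lt_aleph0_iff, collapse_eq_zero_iff]
    refine or_congr (and_congr_right fun h0 => ?_) Iff.rfl
    exact collapse_lt_collapse_iff (hC _).1 h0
  | boxbox φ ih =>
    have h := Set.subset_union_right.trans hφ
    simp only [DTML.depth] at hx
    have hd : x.1.depth + 1 < d := by omega
    have hY : ∀ y : (M.collapsed 𝓧 s₀ d C).World, y.1.depth = x.1.depth + 1 + 1 →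
        (y ∈ {w | Sat e' φ w} ↔ y.1.world ∈ {w | Sat e φ w}) :=
      fun y hy => ih h y (by omega)
    have hY' : ∀ y : (M.collapsed 𝓧 s₀ d C).World, y.1.depth = x.1.depth + 1 + 1 →
        (y ∈ {w | Sat e' φ w}ᶜ ↔ y.1.world ∈ {w | Sat e φ w}ᶜ) :=
      fun y hy => not_congr (hY y hy)
    have hX := (mem_truthSets e φ).1
    have hX' := (mem_truthSets e φ).2
    have hpairs := pairs_collapsed x hd (h hX') hY'
    have huniv := pairs_collapsed x hd h𝓧 (Y := Set.univ) fun _ _ => Iff.rfl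
    rw [sat_boxbox_iff hM, sat_boxbox_iff hM']
    rcases lt_or_ge (M.pairs x.1.world Set.univ) ℵ₀ with h0 | h0
    · have h1 : (M.collapsed 𝓧 s₀ d C).pairs x Set.univ < ℵ₀ := by
        rw [huniv, collapse_lt_aleph0_iff]
        exact repPairs_lt_aleph0 h𝓧 h0
      simp only [h0, h1, not_le.2 h0, not_le.2 h1, false_and, false_or, true_and]
      rw [hpairs, collapse_eq_zero_iff, repPairs_eq_zero (h hX')]
    · have hreg := hM.isRegular_pairs _ h0
      have hCx := (hC x.1).2
      rw [repPairs_univ hreg h𝓧] at huniv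
      have h1 : ℵ₀ ≤ (M.collapsed 𝓧 s₀ d C).pairs x Set.univ := by
        rw [huniv]
        exact aleph0_le_collapse h0
      simp only [h0, h1, not_lt.2 h0, not_lt.2 h1, false_and, or_false, true_and]
      rw [hpairs, heavy_collapsed x hd (h hX) hY hCx h0 huniv,
        heavy_collapsed x hd (h hX') hY' hCx h0 huniv, huniv, collapse_le_collapse_iff hCx h0,
        collapse_lt_collapse_iff hCx h0, collapse_lt_collapse_iff hCx h0,
        collapse_lt_collapse_iff hCx h0, repPairs_lt_pairs_iff hreg (h hX')]

theorem exists_collapsed (hM : M.Regular) (e : M.Enumeration) (φ : DTML P) (s : M.World)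
    (hs : Sat e φ s) :
    ∃ N : KripkeModel.{u, v} P, N.Regular ∧ #N.World < ℵ_ (ω : Ordinal.{u}) ∧
      ∃ w : N.World, ∀ e' : N.Enumeration, Sat e' φ w := by
  classical
  -- `Set.univ` is added so that the totals `kap` and `pairs` are also controlled by the profiles.
  let 𝓨 : Set (Set M.World) := insert Set.univ (truthSets e φ)
  have : Finite 𝓨 := ((finite_truthSets e φ).insert _).to_subtype
  have hfin := (Set.finite_range fun p : M.Node 𝓨 s φ.depth => M.kap p.world).union
    (Set.finite_range fun p : M.Node 𝓨 s φ.depth => M.pairs p.world Set.univ)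
  let C := hfin.toFinset
  refine ⟨M.collapsed 𝓨 s φ.depth C, regular_of_mk_lt mk_collapsed_lt, mk_collapsed_lt,
    (⟨(⟨0⟩, s), rfl⟩,
      (Cardinal.mk_ne_zero_iff.1 (by simp [(Cardinal.aleph_pos _).ne'])).some), fun e' => ?_⟩
  refine (sat_collapsed_iff hM e e' (Set.mem_insert _ _) (fun p => ?_) φ (Set.subset_insert _ _) _
    ?_).2 hs
  · simp [C]
  · exact (Nat.zero_add _).le

end KripkeModel

theorem mainTheorem1 {P : Type v}
    (E : ∀ M : KripkeModel.{u, v} P, M.Enumeration) (φ : DTML P) :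
    (∃ M : KripkeModel.{u, v} P, M.Regular ∧
        ∃ s : M.World, KripkeModel.Sat (E M) φ s) ↔
    (∃ M : KripkeModel.{u, v} P, M.Regular ∧ #M.World < ℵ_ (ω : Ordinal.{u}) ∧
        ∃ s : M.World, KripkeModel.Sat (E M) φ s) := by
  constructor
  · rintro ⟨M, hM, s, hs⟩
    obtain ⟨N, hN, hlt, w, hw⟩ := KripkeModel.exists_collapsed hM (E M) φ s hs
    exact ⟨N, hN, hlt, w, hw (E N)⟩
  · rintro ⟨M, hM, -, s, hs⟩
    exact ⟨M, hM, s, hs⟩
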